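/- Call a finite simple graph $k$-chromatic if its chromatic number is $k$, and $\ell$-connected if it has more than $\ell$ vertices and every graph obtained from it by deleting fewer than $\ell$ vertices is connected. Let $n,k,\ell$ be non-negative integers with $k-1>\ell>1$ and $\ell>n-k$. (a) Every $k$-chromatic $\ell$-connected graph $G$ on $n$ vertices satisfies \[ |E(G)| \ \geq\ \binom{k}{2}+\binom{n-k}{2}+(n-k)\bigl(\ell-(n-k-1)\bigr). \] (b) The bound is sharp for all such $n,k,\ell$ with $n\ge k$. Let $G^*$ be the graph obtained from the disjoint union of a complete graph $K_k$ on vertices $v_1,\dots,v_k$ and a complete graph $K_{n-k}$ on vertices $w_1,\dots,w_{n-k}$ by adding, for each $1\le i\le n-k$, the $\ell-(n-k-1)$ edges $w_iv_j$ with $i\le j\le i+(\ell-(n-k))$. Then $G^*$ is an $n$-vertex $k$-chromatic $\ell$-connected graph with exactly \[ \binom{k}{2}+\binom{n-k}{2}+(n-k)\bigl(\ell-(n-k-1)\bigr) \] edges. -/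

import Mathlib

/-- A finite graph `G` is `ℓ`-connected if it has more than `ℓ` vertices and every graph obtained
from it by deleting fewer than `ℓ` vertices is connected. -/
def IsVertexConnected {V : Type*} [Fintype V] (G : SimpleGraph V) (ℓ : ℕ) : Prop :=
  ℓ < Fintype.card V ∧
    ∀ S : Finset V, S.card < ℓ → (G.induce {v : V | v ∉ S}).Connected

/-- Adjacency in `starMatchingGraph`. With vertices numbered from `0`, the vertex `w i` of the
complete graph on `m` vertices is joined to the vertices `v j` of the complete graph on `k`
vertices with `i ≤ j ≤ i + (ℓ - m)`. -/
def starMatchingAdj (k m ℓ : ℕ) : Fin k ⊕ Fin m → Fin k ⊕ Fin m → Prop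
  | .inl a, .inl b => a ≠ b
  | .inr a, .inr b => a ≠ b
  | .inl j, .inr i => (i : ℕ) ≤ j ∧ (j : ℕ) + m ≤ i + ℓ
  | .inr i, .inl j => (i : ℕ) ≤ j ∧ (j : ℕ) + m ≤ i + ℓ

/-- The disjoint union of the complete graphs on `k` and on `m` vertices, together with the edges
of `m` stars, centred at the vertices of the second complete graph, with `ℓ - (m - 1)` consecutive
leaves each (when `m ≤ ℓ ≤ k`) among the first `ℓ` vertices of the first complete graph. -/
def starMatchingGraph (k m ℓ : ℕ) : SimpleGraph (Fin k ⊕ Fin m) where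
  Adj := starMatchingAdj k m ℓ
  symm := ⟨by
    rintro (a | a) (b | b) h
    · exact Ne.symm h
    · exact h
    · exact h
    · exact Ne.symm h⟩
  loopless := ⟨by
    rintro (a | a) h
    · exact h rfl
    · exact h rfl⟩

/-! Put n = k + m and let `F` be the complement of `G`. Colourings of `G` are clique partitions of
`F`, so these have at least |V| - m parts. Minimum degree at least ℓ in `G` bounds the degrees in
`F` by D = n - 1 - ℓ, and m < D. It remains to see that |E(F)| ≤ m * D
(`card_edgeFinset_le_of_isCliquePartition`). Induct on m. If isolating some vertex allows m - 1 in
place of m, at most D edges are lost. Otherwise every vertex is a singleton in some optimal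
partition, which forces all degrees to be at most m. Matchings have at most m edges, since each
yields a clique partition, and `card_edgeFinset_le_of_matching` gives |E(F)| ≤ m * (m + 1) ≤ m * D.
That bound has a similar induction, whose remaining case is Gallai's lemma. -/

section

open Finset Equiv

/-! ### Matchings as involutions -/

/-- A matching of `F`, encoded as the involution that exchanges the ends of every matching edge
and fixes the unmatched vertices. -/
def IsMatchingPerm {V : Type*} (F : SimpleGraph V) (σ : Perm V) : Prop :=
  (∀ v, σ (σ v) = v) ∧ ∀ v, σ v ≠ v → F.Adj v (σ v)

namespace IsMatchingPerm

variable {V : Type*} {F : SimpleGraph V}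

lemma one : IsMatchingPerm F 1 := ⟨fun _ => rfl, fun _ h => (h rfl).elim⟩

lemma mono {F' : SimpleGraph V} {σ : Perm V} (h : IsMatchingPerm F σ) (hF : F ≤ F') :
    IsMatchingPerm F' σ :=
  ⟨h.1, fun v hv => hF (h.2 v hv)⟩

variable [Fintype V] [DecidableEq V]

lemma even_card_support {σ : Perm V} (h : IsMatchingPerm F σ) : 2 ∣ #σ.support :=
  Perm.two_dvd_card_support (by ext v; simpa [sq] using h.1 v)

/-- Adding an edge between two unmatched vertices. -/
lemma mul_swap {σ : Perm V} (h : IsMatchingPerm F σ) {x y : V} (hxy : F.Adj x y)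
    (hx : σ x = x) (hy : σ y = y) :
    IsMatchingPerm F (σ * swap x y) ∧ #(σ * swap x y).support = #σ.support + 2 := by
  have hne := hxy.ne
  have hinj : ∀ a b, σ a = σ b → a = b := fun a b e => σ.injective e
  refine ⟨⟨fun v => ?_, fun v hv => ?_⟩, ?_⟩
  · have := h.1 v
    simp only [Perm.mul_apply, swap_apply_def]
    grind
  · have h2 := h.2 v
    have := hxy.symm
    simp only [Perm.mul_apply, swap_apply_def] at hv ⊢
    grind
  · have hd : Perm.Disjoint σ (swap x y) := by
      intro v
      simp only [swap_apply_def]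
      grind
    rw [hd.card_support_mul, Perm.card_support_swap hne]

omit [Fintype V] in
/-- Replacing the matching edge `yz` by the edge `xy`, where `x` is unmatched. -/
lemma conj_swap {σ : Perm V} (h : IsMatchingPerm F σ) {x y : V} (hxy : F.Adj x y)
    (hx : σ x = x) (hy : σ y ≠ y) :
    IsMatchingPerm F (swap x (σ y) * σ * swap x (σ y)) := by
  have hne := hxy.ne
  have hyy := h.1 y
  have hinj : ∀ a b, σ a = σ b → a = b := fun a b e => σ.injective e
  refine ⟨fun v => ?_, fun v hv => ?_⟩
  · have := h.1 (swap x (σ y) v)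
    simp [Perm.mul_apply, this]
  · have h2 := h.2 v
    have := hxy.symm
    simp only [Perm.mul_apply, swap_apply_def] at hv ⊢
    grind

end IsMatchingPerm

/-! ### Gallai's lemma and the edge bound from degree and matching number -/

section Gallai

variable {V : Type*} [Fintype V] [DecidableEq V] {F : SimpleGraph V} {ν : ℕ}

/-- `u` and `w` are equal, or no matching with `2 * ν` matched vertices misses both. -/
def NotBothMissed (F : SimpleGraph V) (ν : ℕ) (u w : V) : Prop :=
  u = w ∨ ∀ σ : Perm V, IsMatchingPerm F σ → #σ.support = 2 * ν → σ u = u → σ w ≠ w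

/-- If `M` misses `u` and `w`, take `N` missing `t` that agrees with `M` as much as possible. An
exchange along an edge of `M` increases the agreement. -/
lemma NotBothMissed.trans (hmax : ∀ σ : Perm V, IsMatchingPerm F σ → #σ.support ≤ 2 * ν)
    {u t w : V} (ht : ∃ σ : Perm V, IsMatchingPerm F σ ∧ #σ.support = 2 * ν ∧ σ t = t)
    (h₁ : NotBothMissed F ν u t) (h₂ : NotBothMissed F ν t w) : NotBothMissed F ν u w := by
  classical
  rcases h₁ with rfl | h₁
  · exact h₂
  rcases h₂ with rfl | h₂
  · exact Or.inr h₁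
  by_cases huw : u = w
  · exact Or.inl huw
  refine Or.inr fun M hM hMc hMu hMw => ?_
  obtain ⟨σ₀, hσ₀⟩ := ht
  obtain ⟨N, hN, hNmax⟩ := exists_max_image
    (univ.filter fun σ : Perm V => IsMatchingPerm F σ ∧ #σ.support = 2 * ν ∧ σ t = t)
    (fun σ => #(M.support.filter fun v => M v = σ v)) ⟨σ₀, by simpa using hσ₀⟩
  simp only [mem_filter, mem_univ, true_and] at hN hNmax
  obtain ⟨hN, hNc, hNt⟩ := hN
  have hNu : N u ≠ u := fun h => h₁ N hN hNc h hNt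
  have hNw : N w ≠ w := h₂ N hN hNc hNt
  have hcard : #(M.support \ N.support) = #(N.support \ M.support) :=
    card_sdiff_comm (hMc.trans hNc.symm)
  -- `N` covers both `u` and `w`. By equal sizes, `M` covers two vertices missed by `N`, one of
  -- which is not `t`.
  have htwo : 2 ≤ #(N.support \ M.support) := by
    rw [← card_pair huw]
    refine card_le_card fun a ha => ?_
    rw [mem_insert, mem_singleton] at ha
    rcases ha with rfl | rfl <;> simp [*]
  obtain ⟨x, hx, hxt⟩ := exists_mem_ne (s := M.support \ N.support) (by omega) t
  simp only [mem_sdiff, Perm.mem_support, not_not] at hx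
  obtain ⟨hMx, hNx⟩ := hx
  have hadj := hM.2 x hMx
  have hMM := hM.1 x
  set y := M x with hy
  -- Otherwise `xy` would augment `N`.
  have hNy : N y ≠ y := by
    intro h
    have := hN.mul_swap hadj hNx h
    have := hmax _ this.1
    omega
  have hinj : ∀ a b, N a = N b → a = b := fun a b e => N.injective e
  have hinjM : ∀ a b, M a = M b → a = b := fun a b e => M.injective e
  have hNN := hN.1 y
  set N' := swap x (N y) * N * swap x (N y) with hN'
  have hval : ∀ v, N' v = swap x (N y) (N (swap x (N y) v)) := fun v => rfl
  have hle := hNmax N' ⟨hN.conj_swap hadj hNx hNy, by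
    have := Perm.card_support_conj (σ := swap x (N y)) (τ := N)
    rw [swap_inv] at this
    rw [hN', this, hNc], by
    rw [hval]; simp only [swap_apply_def]; grind⟩
  refine absurd hle (not_le.2 (card_lt_card ?_))
  rw [ssubset_iff_of_subset]
  · refine ⟨x, ?_, ?_⟩
    · rw [mem_filter, hval]
      refine ⟨Perm.mem_support.2 hMx, ?_⟩
      simp only [swap_apply_def]; grind
    · simp only [mem_filter, not_and]
      grind
  · intro v hv
    rw [mem_filter] at hv ⊢
    refine ⟨hv.1, ?_⟩
    rw [hval]; simp only [swap_apply_def]; grind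

/-- Adjacent vertices cannot both be missed, as their edge would augment the matching; transitivity
extends this along walks. -/
lemma notBothMissed_of_reachable
    (hmax : ∀ σ : Perm V, IsMatchingPerm F σ → #σ.support ≤ 2 * ν)
    (hmiss : ∀ t, ∃ σ : Perm V, IsMatchingPerm F σ ∧ #σ.support = 2 * ν ∧ σ t = t)
    {u w : V} (h : F.Reachable u w) : NotBothMissed F ν u w := by
  rw [SimpleGraph.reachable_iff_reflTransGen] at h
  induction h with
  | refl => exact Or.inl rfl
  | tail _ hbc ih =>
    refine ih.trans hmax (hmiss _) (Or.inr fun σ hσ hc hb hc' => ?_)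
    have := hσ.mul_swap hbc hb hc'
    have := hmax _ this.1
    omega

/-- If every vertex is missed by a maximum matching, then there are at least as many components
as vertices missed by a maximum matching (Gallai). -/
lemma card_edgeFinset_le_of_forall_missed [DecidableRel F.Adj] {d : ℕ}
    (hd : ∀ v, F.degree v ≤ d)
    (hmax : ∀ σ : Perm V, IsMatchingPerm F σ → #σ.support ≤ 2 * ν)
    (hmiss : ∀ t, ∃ σ : Perm V, IsMatchingPerm F σ ∧ #σ.support = 2 * ν ∧ σ t = t)
    (hσ : ∃ σ : Perm V, IsMatchingPerm F σ ∧ #σ.support = 2 * ν) :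
    #F.edgeFinset ≤ ν * (d + 1) := by
  classical
  obtain ⟨σ, hσ, hσc⟩ := hσ
  have hfix : #σ.supportᶜ ≤ Fintype.card F.ConnectedComponent := by
    refine card_le_card_of_injOn F.connectedComponentMk (fun _ _ => mem_univ _) ?_
    intro a ha b hb hab
    simp only [coe_compl, Set.mem_compl_iff, mem_coe, Perm.mem_support, not_not] at ha hb
    rcases notBothMissed_of_reachable hmax hmiss (SimpleGraph.ConnectedComponent.eq.1 hab)
      with h | h
    · exact h
    · exact (h σ hσ hσc ha hb).elim
  have hsum := F.sum_degrees_eq_twice_card_edges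
  set cls : F.ConnectedComponent → Finset V :=
    fun C => univ.filter fun v => F.connectedComponentMk v = C with hcls
  have hcount : Fintype.card V = ∑ C, #(cls C) :=
    card_eq_sum_card_fiberwise (fun _ _ => mem_univ _)
  have hpos : ∀ C, 1 ≤ #(cls C) := by
    intro C
    induction C using SimpleGraph.ConnectedComponent.ind with
    | _ v => exact card_pos.2 ⟨v, by simp [hcls]⟩
  have hdeg : ∑ v, F.degree v = ∑ C, ∑ v ∈ cls C, F.degree v :=
    (sum_fiberwise univ F.connectedComponentMk fun v => F.degree v).symm
  -- On s vertices the degree sum is at most s * d and s * (s - 1); one of these is at most (s - 1)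
  -- * (d + 1), according to whether s exceeds d.
  have hC : ∀ C, ∑ v ∈ cls C, F.degree v + (d + 1) ≤ #(cls C) * (d + 1) := by
    intro C
    have h1 : ∑ v ∈ cls C, F.degree v ≤ #(cls C) * d := by
      simpa using sum_le_card_nsmul (cls C) _ d (fun v _ => hd v)
    have h2 : ∑ v ∈ cls C, F.degree v ≤ #(cls C) * (#(cls C) - 1) := by
      refine (sum_le_card_nsmul (cls C) _ (#(cls C) - 1) (fun v hv => ?_)).trans (by simp)
      rw [← card_erase_of_mem hv]
      refine card_le_card fun w hw => ?_
      rw [SimpleGraph.mem_neighborFinset] at hw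
      simp only [hcls, mem_filter, mem_univ, true_and, mem_erase] at hv ⊢
      exact ⟨hw.ne', by rw [← hv]; exact SimpleGraph.ConnectedComponent.eq.2 hw.symm.reachable⟩
    have h3 := hpos C
    generalize #(cls C) = s at h1 h2 h3
    obtain ⟨s, rfl⟩ : ∃ r, s = r + 1 := ⟨s - 1, by omega⟩
    rw [Nat.add_sub_cancel] at h2
    rcases le_total s d with h | h
    · have : (s + 1) * s ≤ (d + 1) * s := Nat.mul_le_mul_right _ (by omega)
      nlinarith
    · nlinarith
  have htot := sum_le_sum fun C (_ : C ∈ univ) => hC C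
  rw [sum_add_distrib, ← sum_mul, ← hdeg, ← hcount, hsum] at htot
  simp only [sum_const, card_univ, smul_eq_mul] at htot
  rw [card_compl] at hfix
  have hle : #σ.support ≤ Fintype.card V := card_le_univ _
  have : Fintype.card V ≤ Fintype.card F.ConnectedComponent + 2 * ν := by omega
  have := Nat.mul_le_mul_right (d + 1) this
  nlinarith

end Gallai

/-- A graph of maximum degree at most `d` whose matchings have at most `ν` edges has at most
`ν * (d + 1)` edges. -/
theorem card_edgeFinset_le_of_matching {V : Type*} [Fintype V] [DecidableEq V] {d : ℕ} (ν : ℕ)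
    (F : SimpleGraph V) [DecidableRel F.Adj] (hd : ∀ v, F.degree v ≤ d)
    (hmax : ∀ σ : Perm V, IsMatchingPerm F σ → #σ.support ≤ 2 * ν) :
    #F.edgeFinset ≤ ν * (d + 1) := by
  induction ν generalizing F with
  | zero =>
    refine card_edgeFinset_le_of_forall_missed hd hmax (fun t => ⟨1, .one, ?_, rfl⟩)
      ⟨1, .one, ?_⟩ <;> simp
  | succ ν ih =>
    by_cases hv : ∃ v, ∀ σ : Perm V, IsMatchingPerm (F.deleteIncidenceSet v) σ →
        #σ.support ≤ 2 * ν
    · obtain ⟨v, hv⟩ := hv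
      have h := ih (F.deleteIncidenceSet v) (fun w => (SimpleGraph.degree_le_of_le
        (F.deleteIncidenceSet_le v)).trans (hd w)) hv
      have h2 := F.card_edgeFinset_deleteIncidenceSet v
      have := hd v
      rw [add_mul]
      omega
    · push Not at hv
      have hmiss : ∀ t, ∃ σ : Perm V, IsMatchingPerm F σ ∧ #σ.support = 2 * (ν + 1) ∧
          σ t = t := by
        intro t
        obtain ⟨σ, hσ, hc⟩ := hv t
        have h1 := hσ.mono (F.deleteIncidenceSet_le t)
        refine ⟨σ, h1, ?_, ?_⟩
        · have := hmax σ h1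
          have := hσ.even_card_support
          omega
        · by_contra h
          exact (SimpleGraph.deleteIncidenceSet_adj.1 (hσ.2 t h)).2.1 rfl
      rcases isEmpty_or_nonempty V with hV | ⟨⟨t⟩⟩
      · rw [card_eq_zero.2 (eq_empty_of_forall_notMem fun e => e.ind fun a => isEmptyElim a)]
        exact Nat.zero_le _
      · obtain ⟨σ, h1, h2, -⟩ := hmiss t
        exact card_edgeFinset_le_of_forall_missed hd hmax hmiss ⟨σ, h1, h2⟩

/-! ### Edge bound from clique partitions -/

/-- A partition of the vertices of `F` into cliques, encoded by the labels of the parts. -/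
def IsCliquePartition {V α : Type*} (F : SimpleGraph V) (f : V → α) : Prop :=
  ∀ u v, f u = f v → u = v ∨ F.Adj u v

section CliquePartition

variable {V : Type*} [Fintype V] [DecidableEq V] {F : SimpleGraph V} {m : ℕ}

/-- The matching edges and the unmatched singletons form a clique partition, each edge saving one
part. -/
lemma IsMatchingPerm.card_support_le {σ : Perm V} (hσ : IsMatchingPerm F σ)
    (hc : ∀ f : V → Finset V, IsCliquePartition F f → Fintype.card V ≤ #(univ.image f) + m) :
    #σ.support ≤ 2 * m := by
  set f : V → Finset V := fun v => {v, σ v} with hf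
  have hfσ : ∀ v, f (σ v) = f v := fun v => by simp only [hf, hσ.1 v, pair_comm]
  have h1 := hc f fun u v huv => by
    have hu : u ∈ f v := huv ▸ mem_insert_self u _
    rw [hf, mem_insert, mem_singleton] at hu
    rcases hu with rfl | rfl
    · exact Or.inl rfl
    · by_cases h : σ v = v
      · exact Or.inl h
      · exact Or.inr (hσ.2 v h).symm
  have h2 : 2 * #(σ.support.image f) ≤ #σ.support := by
    refine mul_card_image_le_card _ _ fun b hb => ?_
    obtain ⟨v, hv, rfl⟩ := mem_image.1 hb
    have hne := Perm.mem_support.1 hv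
    rw [← card_pair hne]
    refine card_le_card fun w hw => ?_
    rw [mem_insert, mem_singleton] at hw
    rcases hw with rfl | rfl
    · simpa [hfσ, hσ.1 v] using hne.symm
    · simpa using hne
  have h3 : #(univ.image f) ≤ #(σ.support.image f) + #(σ.supportᶜ.image f) := by
    rw [← union_compl σ.support, image_union]
    exact card_union_le _ _
  have h4 : #(σ.supportᶜ.image f) ≤ #σ.supportᶜ := card_image_le
  have h5 := card_add_card_compl σ.support
  omega

/-- Every part contains a non-neighbour of `v` (for its own part, `v` itself): otherwise `v` could
move into it, leaving one part fewer than the minimum. So at least |V| - m vertices are not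
neighbours of `v`. -/
lemma degree_le_of_isCliquePartition [DecidableRel F.Adj]
    (hc : ∀ f : V → Finset V, IsCliquePartition F f → Fintype.card V ≤ #(univ.image f) + m)
    {f : V → Finset V} (hf : IsCliquePartition F f) (hfm : #(univ.image f) + m ≤ Fintype.card V)
    {v : V} (hv : ∀ u, f u = f v → u = v) : F.degree v ≤ m := by
  have key : univ.image f ⊆ (F.neighborFinset v)ᶜ.image f := by
    intro b hb
    by_contra hcon
    have hadj : ∀ u, f u = b → F.Adj v u := by
      intro u hu
      by_contra h
      exact hcon (mem_image.2 ⟨u, by simpa using h, hu⟩)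
    have hbv : b ≠ f v := fun h => F.loopless.irrefl v (hadj v h.symm)
    have h1 := hc (Function.update f v b) fun u w huw => by
      by_cases hu : u = v <;> by_cases hw : w = v
      · exact Or.inl (hu.trans hw.symm)
      · subst hu
        rw [Function.update_self, Function.update_of_ne hw] at huw
        exact Or.inr (hadj w huw.symm)
      · subst hw
        rw [Function.update_self, Function.update_of_ne hu] at huw
        exact Or.inr (hadj u huw).symm
      · rw [Function.update_of_ne hu, Function.update_of_ne hw] at huw
        exact hf u w huw
    have h2 : #(univ.image (Function.update f v b)) < #(univ.image f) := by
      refine card_lt_card ((ssubset_iff_of_subset fun x hx => ?_).2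
        ⟨f v, mem_image_of_mem f (mem_univ v), fun hx => ?_⟩)
      · obtain ⟨u, -, rfl⟩ := mem_image.1 hx
        by_cases hu : u = v
        · subst hu
          rwa [Function.update_self]
        · rw [Function.update_of_ne hu]
          exact mem_image_of_mem f (mem_univ u)
      · obtain ⟨u, -, hu⟩ := mem_image.1 hx
        by_cases huv : u = v
        · subst huv
          rw [Function.update_self] at hu
          exact hbv hu
        · rw [Function.update_of_ne huv] at hu
          exact huv (hv u hu)
    omega
  have h1 := (card_le_card key).trans card_image_le
  have h2 := card_add_card_compl (F.neighborFinset v)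
  have h3 := hc f hf
  rw [SimpleGraph.card_neighborFinset_eq_degree] at h2
  omega

/-- If every partition of the vertices of `F` into cliques has at least `|V| - m` parts and `F`
has maximum degree at most `D`, where `m < D`, then `F` has at most `m * D` edges. -/
theorem card_edgeFinset_le_of_isCliquePartition {D : ℕ} (m : ℕ) (F : SimpleGraph V)
    [DecidableRel F.Adj] (hD : ∀ v, F.degree v ≤ D) (hm : m < D)
    (hc : ∀ f : V → Finset V, IsCliquePartition F f → Fintype.card V ≤ #(univ.image f) + m) :
    #F.edgeFinset ≤ m * D := by
  have of_degree {m : ℕ} {F : SimpleGraph V} [DecidableRel F.Adj] (hm : m < D)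
      (hc : ∀ f : V → Finset V, IsCliquePartition F f → Fintype.card V ≤ #(univ.image f) + m)
      (hdeg : ∀ v, F.degree v ≤ m) : #F.edgeFinset ≤ m * D :=
    (card_edgeFinset_le_of_matching m F hdeg fun _ hσ => hσ.card_support_le hc).trans
      (Nat.mul_le_mul_left m hm)
  induction m generalizing F with
  | zero =>
    refine of_degree hm hc fun v => degree_le_of_isCliquePartition hc (f := fun v => {v})
      (fun u w h => Or.inl (singleton_injective h)) ?_ (fun u h => singleton_injective h)
    exact card_image_le
  | succ m ih =>
    by_cases hv : ∃ v, ∀ f : V → Finset V, IsCliquePartition (F.deleteIncidenceSet v) f →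
        Fintype.card V ≤ #(univ.image f) + m
    · obtain ⟨v, hv⟩ := hv
      have h := ih (F.deleteIncidenceSet v) (fun w => (SimpleGraph.degree_le_of_le
        (F.deleteIncidenceSet_le v)).trans (hD w)) (by omega) hv
      have h2 := F.card_edgeFinset_deleteIncidenceSet v
      have := hD v
      rw [add_mul]
      omega
    · push Not at hv
      refine of_degree hm hc fun v => ?_
      obtain ⟨f, hf, hfm⟩ := hv v
      refine degree_le_of_isCliquePartition hc
        (fun u w h => (hf u w h).imp_right fun h => F.deleteIncidenceSet_le v h) (by omega)
        -- `v` is isolated after the deletion, so its part is a singleton.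
        fun u h => (hf u v h).resolve_right fun h =>
          (SimpleGraph.deleteIncidenceSet_adj.1 h).2.2 rfl

end CliquePartition

/-! ### From connectivity and chromatic number to the lower bound -/

lemma IsVertexConnected.le_degree {V : Type*} [Fintype V] {G : SimpleGraph V}
    [DecidableRel G.Adj] {ℓ : ℕ} (h : IsVertexConnected G ℓ) (v : V) : ℓ ≤ G.degree v := by
  classical
  by_contra! hlt
  obtain ⟨w, hw⟩ : ∃ w, w ∉ insert v (G.neighborFinset v) := by
    by_contra! hall
    have h1 := h.1
    rw [← card_univ, ← eq_univ_iff_forall.2 hall] at h1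
    have h2 := card_insert_le v (G.neighborFinset v)
    rw [SimpleGraph.card_neighborFinset_eq_degree] at h2
    omega
  rw [mem_insert, not_or] at hw
  have hcon := h.2 (G.neighborFinset v) hlt
  obtain ⟨p⟩ := hcon.preconnected ⟨v, by simp⟩ ⟨w, hw.2⟩
  cases p with
  | nil => exact hw.1 rfl
  | @cons _ x _ hadj _ => exact x.2 (by simpa using hadj)

/-- The number of edges of a `k`-chromatic `ℓ`-connected graph on `k + m` vertices. -/
theorem choose_two_le_card_edgeFinset {V : Type*} [Fintype V] [DecidableEq V]
    {G : SimpleGraph V} [DecidableRel G.Adj] {k m ℓ : ℕ} (hV : Fintype.card V = k + m)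
    (hG : G.chromaticNumber = k) (hℓ : IsVertexConnected G ℓ) (hk : ℓ + 1 < k) :
    (k + m).choose 2 ≤ #G.edgeFinset + m * (k + m - 1 - ℓ) := by
  have h1 := card_edgeFinset_le_of_isCliquePartition (D := k + m - 1 - ℓ) m Gᶜ (fun v => by
      have := hℓ.le_degree v
      rw [SimpleGraph.degree_compl, hV]
      omega) (by omega) fun f hf => by
    have hcol : G.Colorable #(univ.image f) := by
      have c : G.Coloring (univ.image f) := SimpleGraph.Coloring.mk
        (fun v => ⟨f v, mem_image_of_mem f (mem_univ v)⟩) fun {u w} hadj heq => by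
          rcases hf u w (congrArg Subtype.val heq) with rfl | h
          · exact hadj.ne rfl
          · exact h.2 hadj
      simpa only [Fintype.card_coe] using c.colorable
    have := hcol.chromaticNumber_le
    rw [hG, Nat.cast_le] at this
    omega
  have h2 : #G.edgeFinset + #Gᶜ.edgeFinset = (k + m).choose 2 := by
    rw [← hV, ← SimpleGraph.card_edgeFinset_top_eq_card_choose_two,
      ← card_union_of_disjoint (SimpleGraph.disjoint_edgeFinset.2 disjoint_compl_right),
      ← SimpleGraph.edgeFinset_sup]
    congr!
    exact sup_compl_eq_top
  omega

lemma IsVertexConnected.of_iso {V W : Type*} [Fintype V] [Fintype W] {G : SimpleGraph V}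
    {H : SimpleGraph W} (e : G ≃g H) {ℓ : ℕ} (h : IsVertexConnected H ℓ) :
    IsVertexConnected G ℓ := by
  classical
  refine ⟨(Fintype.card_congr e.toEquiv).symm ▸ h.1, fun S hS => ?_⟩
  have h1 := h.2 (S.map e.toEquiv.toEmbedding) (by rwa [card_map])
  let i : G.induce {v : V | v ∉ S} ≃g H.induce {w : W | w ∉ S.map e.toEquiv.toEmbedding} :=
    { toEquiv := e.toEquiv.subtypeEquiv fun v =>
        not_congr (mem_map' e.toEquiv.toEmbedding).symm
      map_rel_iff' := fun {a b} => e.map_adj_iff }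
  exact i.connected_iff.2 h1

/-! ### The extremal graph -/

namespace starMatchingGraph

variable {k m ℓ : ℕ}

lemma adj_inl_inl {a b : Fin k} :
    (starMatchingGraph k m ℓ).Adj (.inl a) (.inl b) ↔ a ≠ b := Iff.rfl

lemma adj_inr_inr {a b : Fin m} :
    (starMatchingGraph k m ℓ).Adj (.inr a) (.inr b) ↔ a ≠ b := Iff.rfl

lemma adj_inl_inr {j : Fin k} {i : Fin m} : (starMatchingGraph k m ℓ).Adj (.inl j) (.inr i) ↔
    (i : ℕ) ≤ j ∧ (j : ℕ) + m ≤ i + ℓ := Iff.rfl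

lemma adj_inr_inl {j : Fin k} {i : Fin m} : (starMatchingGraph k m ℓ).Adj (.inr i) (.inl j) ↔
    (i : ℕ) ≤ j ∧ (j : ℕ) + m ≤ i + ℓ := Iff.rfl

lemma chromaticNumber_eq (hm : m < ℓ) (hk : ℓ + 1 < k) :
    (starMatchingGraph k m ℓ).chromaticNumber = k := by
  refine le_antisymm ?_ ?_
  · have c : (starMatchingGraph k m ℓ).Coloring (Fin k) := SimpleGraph.Coloring.mk
      -- `w i` takes the colour of the first vertex beyond its star.
      (Sum.elim id fun i => ⟨i + (ℓ - m) + 1, by omega⟩) (by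
        rintro (a | a) (b | b) h heq
        · exact h heq
        · have := congrArg Fin.val heq
          have := adj_inl_inr.1 h
          simp at *
          omega
        · have := congrArg Fin.val heq
          have := adj_inr_inl.1 h
          simp at *
          omega
        · have := congrArg Fin.val heq
          refine h (Fin.ext ?_)
          simp at this
          omega)
    simpa using c.colorable.chromaticNumber_le
  · exact SimpleGraph.le_chromaticNumber_of_pairwise_adj (by simp) Sum.inl
      fun a b hab => adj_inl_inl.2 hab

/-- After deleting fewer than `ℓ` vertices, some vertex of the second complete graph, if one is
left, has a neighbour left in the first one. -/
lemma exists_adj (hm : m < ℓ) (hk : ℓ + 1 < k) {S : Finset (Fin k ⊕ Fin m)} (hS : #S < ℓ)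
    (hne : ∃ i : Fin m, Sum.inr i ∉ S) :
    ∃ (i : Fin m) (j : Fin k), Sum.inr i ∉ S ∧ Sum.inl j ∉ S ∧
      (starMatchingGraph k m ℓ).Adj (.inr i) (.inl j) := by
  classical
  by_contra! hcon
  obtain ⟨i₀, hi₀, hmin⟩ := exists_min_image (univ.filter fun i : Fin m => Sum.inr i ∉ S)
    (fun i => (i : ℕ)) (by simpa [Finset.Nonempty] using hne)
  simp only [mem_filter, mem_univ, true_and] at hi₀ hmin
  have hdel : ∀ (i : Fin m) (j : Fin k), Sum.inr i ∉ S → (i : ℕ) ≤ j → (j : ℕ) + m ≤ i + ℓ →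
      Sum.inl j ∈ S := fun i j hi h1 h2 => by
    by_contra h
    exact hcon i j hi h (adj_inr_inl.2 ⟨h1, h2⟩)
  -- An injection into `S` contradicting `#S < ℓ`: each deleted `w t`, the last leaf of each
  -- surviving `w t`, and the other ℓ - m leaves of the first survivor `i₀`. Minimality of `i₀` puts
  -- these before all the last leaves used.
  let g : Fin ℓ → Fin k ⊕ Fin m := fun t =>
    if ht : (t : ℕ) < m then
      if Sum.inr ⟨t, ht⟩ ∈ S then Sum.inr ⟨t, ht⟩ else Sum.inl ⟨t + (ℓ - m), by omega⟩
    else Sum.inl ⟨i₀ + (t - m), by omega⟩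
  have hgS : ∀ t, g t ∈ S := by
    intro t
    simp only [g]
    split_ifs with h1 h2
    · exact h2
    · exact hdel _ _ h2 (by simp) (by simp; omega)
    · exact hdel _ _ hi₀ (by simp) (by simp; omega)
  have hginj : Function.Injective g := by
    intro s t hst
    simp only [g] at hst
    refine Fin.ext ?_
    split_ifs at hst with h1 h2 h3 h4 h5 h6 h7 h8
    all_goals first
      | cases hst
      | simp only [Sum.inl.injEq, Sum.inr.injEq, Fin.mk.injEq] at hst
        first
          | omega
          | have := hmin _ h2
            simp only at this
            omega
          | have := hmin _ ‹Sum.inr (⟨t, _⟩ : Fin m) ∉ S›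
            simp only at this
            omega
  have := card_le_card_of_injOn (s := univ) g (fun t _ => hgS t) hginj.injOn
  simp at this
  omega

lemma isVertexConnected (hm : m < ℓ) (hk : ℓ + 1 < k) :
    IsVertexConnected (starMatchingGraph k m ℓ) ℓ := by
  classical
  refine ⟨by simp; omega, fun S hS => ?_⟩
  obtain ⟨a, ha⟩ : ∃ a : Fin k, Sum.inl a ∉ S := by
    by_contra! h
    have := card_le_card_of_injOn (s := univ) (Sum.inl : Fin k → Fin k ⊕ Fin m)
      (fun t _ => h t) Sum.inl_injective.injOn
    simp at this
    omega
  set H := (starMatchingGraph k m ℓ).induce {v | v ∉ S} with hH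
  have of_adj {x y : Fin k ⊕ Fin m} (hx : x ∉ S) (hy : y ∉ S)
      (h : (starMatchingGraph k m ℓ).Adj x y) : H.Reachable ⟨x, hx⟩ ⟨y, hy⟩ :=
    SimpleGraph.Adj.reachable (G := H) h
  have hl (b : Fin k) (hb : Sum.inl b ∉ S) : H.Reachable ⟨_, ha⟩ ⟨_, hb⟩ := by
    by_cases hab : a = b
    · subst hab; exact .rfl
    · exact of_adj ha hb hab
  have hr (b : Fin m) (hb : Sum.inr b ∉ S) : H.Reachable ⟨_, ha⟩ ⟨_, hb⟩ := by
    obtain ⟨i, j, hi, hj, hij⟩ := exists_adj hm hk hS ⟨b, hb⟩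
    refine (hl j hj).trans ((of_adj hj hi hij.symm).trans ?_)
    by_cases h : i = b
    · subst h; exact .rfl
    · exact of_adj hi hb h
  have hall : ∀ x, H.Reachable ⟨_, ha⟩ x := by
    rintro ⟨b | b, hb⟩
    · exact hl b hb
    · exact hr b hb
  exact (SimpleGraph.connected_iff_exists_forall_reachable _).2 ⟨_, hall⟩

lemma two_mul_card_edgeFinset [DecidableRel (starMatchingGraph k m ℓ).Adj] (hm : m < ℓ)
    (hk : ℓ + 1 < k) : 2 * #(starMatchingGraph k m ℓ).edgeFinset =
      k * (k - 1) + m * (m - 1) + 2 * (m * (ℓ - m + 1)) := by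
  classical
  have hstar (i : Fin m) :
      #(univ.filter fun j : Fin k => (i : ℕ) ≤ j ∧ (j : ℕ) + m ≤ i + ℓ) = ℓ - m + 1 := by
    have : (univ.filter fun j : Fin k => (i : ℕ) ≤ j ∧ (j : ℕ) + m ≤ i + ℓ) =
        Finset.Icc (⟨i, by omega⟩ : Fin k) ⟨i + (ℓ - m), by omega⟩ := by
      ext j
      simp only [mem_filter, mem_univ, true_and, mem_Icc, Fin.le_def]
      omega
    rw [this, Fin.card_Icc]
    simp only
    omega
  have hcl (r : ℕ) : ∑ a : Fin r, ∑ b : Fin r, (if a ≠ b then 1 else 0) = r * (r - 1) := by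
    simp only [← card_filter, filter_ne, card_erase_of_mem (mem_univ _)]
    simp
  rw [← SimpleGraph.sum_degrees_eq_twice_card_edges]
  have hdeg (v) : (starMatchingGraph k m ℓ).degree v =
      ∑ w, if (starMatchingGraph k m ℓ).Adj v w then 1 else 0 := by
    rw [← card_filter, ← SimpleGraph.card_neighborFinset_eq_degree,
      SimpleGraph.neighborFinset_eq_filter]
  simp only [hdeg, Fintype.sum_sum_type, sum_add_distrib, adj_inl_inl, adj_inl_inr, adj_inr_inl,
    adj_inr_inr, hcl]
  rw [sum_comm (s := (univ : Finset (Fin k))) (t := (univ : Finset (Fin m)))]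
  simp only [← card_filter, hstar]
  simp
  ring

end starMatchingGraph

end

/-! ### Bound and sharpness combined -/

theorem mainTheorem5 (n k ℓ : ℕ) (hℓ : 1 < ℓ) (hkℓ : (ℓ : ℤ) < (k : ℤ) - 1)
    (hnkℓ : (n : ℤ) - (k : ℤ) < (ℓ : ℤ)) :
    (∀ (V : Type*) [Fintype V] (G : SimpleGraph V), Fintype.card V = n →
      G.chromaticNumber = (k : ℕ∞) → IsVertexConnected G ℓ →
        (k.choose 2 : ℤ) + ((n - k).choose 2 : ℤ) +
          ((n : ℤ) - k) * ((ℓ : ℤ) - ((n : ℤ) - k - 1)) ≤ (G.edgeSet.ncard : ℤ)) ∧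
    (k ≤ n → ∃ G : SimpleGraph (Fin n),
      Nonempty (G ≃g starMatchingGraph k (n - k) ℓ) ∧
      G.chromaticNumber = (k : ℕ∞) ∧ IsVertexConnected G ℓ ∧
        (G.edgeSet.ncard : ℤ) = (k.choose 2 : ℤ) + ((n - k).choose 2 : ℤ) +
          ((n : ℤ) - k) * ((ℓ : ℤ) - ((n : ℤ) - k - 1))) := by
  classical
  have hchoose (r : ℕ) : 2 * (r.choose 2 : ℤ) = r * (r - 1) := by
    induction r with
    | zero => simp
    | succ r ih =>
      rw [Nat.choose_succ_succ' r 1, Nat.choose_one_right]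
      push_cast
      linarith
  refine ⟨fun V _ G hV hG hconn => ?_, fun hkn => ?_⟩
  · have hkn : k ≤ n := by
      have := G.chromaticNumber_le_card
      rwa [hG, hV, Nat.cast_le] at this
    obtain ⟨m, rfl⟩ := Nat.exists_eq_add_of_le hkn
    have h := choose_two_le_card_edgeFinset hV hG hconn (by omega)
    rw [← SimpleGraph.coe_edgeFinset, Set.ncard_coe_finset, Nat.add_sub_cancel_left]
    zify [show ℓ ≤ k + m - 1 by omega, show 1 ≤ k + m by omega] at h
    have h1 := hchoose k
    have h2 := hchoose m
    have h3 := hchoose (k + m)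
    push_cast at h3 ⊢
    linarith
  · obtain ⟨m, rfl⟩ := Nat.exists_eq_add_of_le hkn
    rw [Nat.add_sub_cancel_left]
    have hm : m < ℓ := by push_cast at hnkℓ; omega
    have hk : ℓ + 1 < k := by omega
    let e : (starMatchingGraph k m ℓ).comap finSumFinEquiv.symm ≃g starMatchingGraph k m ℓ :=
      SimpleGraph.Iso.comap finSumFinEquiv.symm _
    refine ⟨_, ⟨e⟩, ?_, (starMatchingGraph.isVertexConnected hm hk).of_iso e, ?_⟩
    · rw [SimpleGraph.chromaticNumber_congr e, starMatchingGraph.chromaticNumber_eq hm hk]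
    · have h := starMatchingGraph.two_mul_card_edgeFinset hm hk
      rw [← SimpleGraph.coe_edgeFinset, Set.ncard_coe_finset, e.card_edgeFinset_eq]
      have h1 := hchoose k
      have h2 := hchoose m
      -- The truncated m - 1 casts to the integer difference only for m ≥ 1.
      rcases Nat.eq_zero_or_pos m with rfl | hpos
      · zify [show 1 ≤ k by omega] at h
        push_cast at *
        linarith
      · zify [show 1 ≤ k by omega, show 1 ≤ m by omega, hm.le] at h
        push_cast
        linarith
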